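/- Let $\mathcal X=\{0,\dots,d-1\}$, let $M_1(\mathcal X)\subset\mathbb R^d$ be the simplex of probability distributions on $\mathcal X$ with the Euclidean topology, and for $q\in M_1(\mathcal X)$ and $\mathbf x^n\in\mathcal X^n$ write $q(\mathbf x^n)=\prod_{k=1}^n q(x_k)$. Let $D(\mu\|\nu)=\sum_{i\in\mathcal X}\mu(i)\log\frac{\mu(i)}{\nu(i)}$ denote the relative entropy. Let $p\in M_1(\mathcal X)$, $Q\subseteq M_1(\mathcal X)$, $c:Q\to\mathbb R_+$ and $0<\varepsilon<1$. Assume: (A1) $Q$ is closed in $M_1(\mathcal X)$ and $p\notin Q$. (A2) $p(i)>0$ for all $i\in\mathcal X$, and $q(i)>0$ for all $q\in Q$ and $i\in\mathcal X$. (A3) $c$ is continuous and has a unique minimizer $q^*\in Q$. (A4) $\{\mu\in M_1(\mathcal X): D(\mu\|p)\le D(\mu\|q^*)\}\cap Q=\emptyset$. For $n\ge 1$ the Neyman–Pearson game $\mathcal G^{NP}(\varepsilon,d,n)$ is the following two-player game. The attacker chooses $q\in Q$; the defender chooses a randomized decision rule from $$\Phi_n=\Big\{\varphi:\mathcal X^n\to[0,1]\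 :\ \sum_{\mathbf x^n}\varphi(\mathbf x^n)\,p(\mathbf x^n)\le\varepsilon\Big\},$$ equipped with the sup-norm metric. With the Type II error $e_n(q,\varphi)=\sum_{\mathbf x^n}(1-\varphi(\mathbf x^n))\,q(\mathbf x^n)$, the utilities are $u_n^A(q,\varphi)=e_n(q,\varphi)-c(q)$ for the attacker and $u_n^D(q,\varphi)=-e_n(q,\varphi)$ for the defender. Mixed strategies are Borel probability measures $\sigma^A$ on $Q$ and $\sigma^D$ on $\Phi_n$; the functions $u_n^A,u_n^D,e_n$ are extended to them by taking expectations under independent randomization, and a mixed strategy Nash equilibrium is a pair $(\sigma^A,\sigma^D)$ from which neither player can increase her own expected utility by a unilateral deviation. Theorem (Neyman–Pearson error exponent). Let $(\hat\sigma^A_n,\hat\sigma^D_n)_{n\ge1}$ be any sequence such that, for each $n\ge 1$, $(\hat\sigma^A_n,\hat\sigma^D_n)$ is a mixed strategy Nash equilibrium of $\mathcal G^{NP}(\varepsilon,d,n)$. Then $e_n(\hat\sigma^A_n,\hat\sigma^D_n)>0$ for every $n\ge1$, and $$\lim_{n\to\infty}\frac1n\log e_n(\hat\sigma^A_n,\hat\sigma^D_n)=-D(p\|q^*).$$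 -/

import Mathlib

open MeasureTheory Filter Topology
open scoped NNReal

noncomputable section

namespace HypothesisGame

/-- `M₁(𝒳)`: probability distributions on the alphabet `𝒳 = {0, …, d - 1}`, as points of the
standard simplex of `ℝ^d` with the subspace (Euclidean) topology. -/
abbrev Distribution (d : ℕ) : Type := stdSimplex ℝ (Fin d)

/-- `q(𝐱ⁿ)`: probability of the word `x` when its symbols are drawn independently from `q`. -/
def wordProb {d n : ℕ} (q : Distribution d) (x : Fin n → Fin d) : ℝ :=
  ∏ k, (q : Fin d → ℝ) (x k)

/-- Relative entropy `D(μ‖ν) = ∑ᵢ μ(i) log (μ(i) / ν(i))`, with `0 log 0 = 0`. It is used only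
for `ν` with full support, so that the value is always finite. -/
def relEntropy {d : ℕ} (μ ν : Distribution d) : ℝ :=
  ∑ i, (μ : Fin d → ℝ) i * Real.log ((μ : Fin d → ℝ) i / (ν : Fin d → ℝ) i)

/-- False alarm probability (Type I error) of the decision rule `φ`, where `φ x` is the
probability of declaring `H₁` on observing `x`. -/
def falseAlarm {d n : ℕ} (p : Distribution d) (φ : (Fin n → Fin d) → ℝ) : ℝ :=
  ∑ x, φ x * wordProb p x

/-- Missed detection probability (Type II error) of `φ` under the alternative `q`. -/
def typeIIError {d n : ℕ} (q : Distribution d) (φ : (Fin n → Fin d) → ℝ) : ℝ :=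
  ∑ x, (1 - φ x) * wordProb q x

/-- `Φ_n`: randomized decision rules on words of length `n` with false alarm probability at
most `ε`. As a subtype it carries the sup-norm metric and its Borel sets. -/
def decisionRules {d : ℕ} (p : Distribution d) (ε : ℝ) (n : ℕ) :
    Set ((Fin n → Fin d) → ℝ) :=
  {φ | (∀ x, φ x ∈ Set.Icc (0 : ℝ) 1) ∧ falseAlarm p φ ≤ ε}

/-- Attacker's utility `u^A_n(q, φ)` for pure strategies. -/
def attackerUtility {d : ℕ} (p : Distribution d) (Q : Set (Distribution d)) (c : Q → ℝ≥0)
    (ε : ℝ) (n : ℕ) (q : Q) (φ : decisionRules p ε n) : ℝ :=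
  typeIIError (q : Distribution d) (φ : (Fin n → Fin d) → ℝ) - (c q : ℝ)

/-- Defender's utility `u^D_n(q, φ)` for pure strategies. -/
def defenderUtility {d : ℕ} (p : Distribution d) (Q : Set (Distribution d))
    (ε : ℝ) (n : ℕ) (q : Q) (φ : decisionRules p ε n) : ℝ :=
  -typeIIError (q : Distribution d) (φ : (Fin n → Fin d) → ℝ)

/-- Expected value of a payoff when the players randomize independently with laws `σ`, `τ`. -/
def mixedExtension {A B : Type} [MeasurableSpace A] [MeasurableSpace B] (u : A → B → ℝ)
    (σ : ProbabilityMeasure A) (τ : ProbabilityMeasure B) : ℝ :=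
  ∫ a, ∫ b, u a b ∂(τ : Measure B) ∂(σ : Measure A)

/-- `(σ, τ)` is a mixed strategy Nash equilibrium of the two-player game with strategy sets
`A`, `B` and utilities `u₁`, `u₂`. -/
def IsMixedNash {A B : Type} [MeasurableSpace A] [MeasurableSpace B] (u₁ u₂ : A → B → ℝ)
    (σ : ProbabilityMeasure A) (τ : ProbabilityMeasure B) : Prop :=
  (∀ σ' : ProbabilityMeasure A, mixedExtension u₁ σ' τ ≤ mixedExtension u₁ σ τ) ∧
  (∀ τ' : ProbabilityMeasure B, mixedExtension u₂ σ τ' ≤ mixedExtension u₂ σ τ)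

/-- Mixed strategy Nash equilibrium of the Neyman–Pearson game `𝒢^{NP}(ε, d, n)`. -/
def IsNPEquilibrium {d : ℕ} (p : Distribution d) (Q : Set (Distribution d)) (c : Q → ℝ≥0)
    (ε : ℝ) (n : ℕ) (σ : ProbabilityMeasure Q)
    (τ : ProbabilityMeasure (decisionRules p ε n)) : Prop :=
  IsMixedNash (attackerUtility p Q c ε n) (defenderUtility p Q ε n) σ τ

/-- `e_n(σ, τ) = -u^D_n(σ, τ)`: the Type II error of the mixed strategy profile `(σ, τ)`. -/
def npError {d : ℕ} (p : Distribution d) (Q : Set (Distribution d))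
    (ε : ℝ) (n : ℕ) (σ : ProbabilityMeasure Q)
    (τ : ProbabilityMeasure (decisionRules p ε n)) : ℝ :=
  -mixedExtension (defenderUtility p Q ε n) σ τ

end HypothesisGame

end

/-! Both error bounds reduce to Stein's lemma at the cheapest alternative `qstar`. The error is
affine in the rule, so the defender's mixture acts as the single admissible rule `meanRule`. Lower
bound: since `qstar` is cheapest, deviating to it shows that the equilibrium error is at least that
of `meanRule` against `qstar`, and the converse of Stein's lemma applies
(`eventually_forall_typeIIError_ge`). Upper bound: the defender may deviate to a Stein test for
`qstar`, which is good against every alternative near `qstar`. The attacker must therefore play near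
`qstar` almost surely. Closeness in mean would not do, because a stray mass of order `1/n` could
spoil the exponent. That localization is `eventually_ae_mem_likelihoodBall`. By (A4) and
compactness, the log-likelihood ratio of `qstar` to `p` has mean bounded below by a positive
constant over `Q`, so one half-space test has error `O(1/n)` against all of `Q`. The equilibrium
error, hence the expected excess cost, is then `O(1/n)`, and half of the attacker's mass lies near
`qstar`. By a Neyman–Pearson exchange (`meanWordProb_le`), `meanRule` must reject surely on the
whole half-space. Its error against each single alternative is thus `O(1/n)`, and no expensive
alternative can be a best response. -/

noncomputable section

namespace HypothesisGame

variable {d n : ℕ}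

/-! ### Product laws of words and their first two moments -/

lemma wordProb_nonneg (q : Distribution d) (x : Fin n → Fin d) : 0 ≤ wordProb q x :=
  Finset.prod_nonneg fun _ _ => q.2.1 _

lemma wordProb_pos {q : Distribution d} (hq : ∀ i, 0 < (q : Fin d → ℝ) i) (x : Fin n → Fin d) :
    0 < wordProb q x :=
  Finset.prod_pos fun _ _ => hq _

lemma wordProb_cons (q : Distribution d) (a : Fin d) (y : Fin n → Fin d) :
    wordProb q (Fin.cons a y : Fin (n + 1) → Fin d) = (q : Fin d → ℝ) a * wordProb q y := by
  simp [wordProb, Fin.prod_univ_succ]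

lemma sum_words_succ (F : (Fin (n + 1) → Fin d) → ℝ) :
    ∑ x, F x = ∑ a, ∑ y : Fin n → Fin d, F (Fin.cons a y) := by
  rw [← (Fin.consEquiv fun _ : Fin (n + 1) => Fin d).sum_comp, Fintype.sum_prod_type]
  rfl

lemma sum_wordProb (q : Distribution d) : ∑ x : Fin n → Fin d, wordProb q x = 1 := by
  induction n with
  | zero => simp [wordProb]
  | succ n ih =>
    simp only [sum_words_succ, wordProb_cons, ← Finset.mul_sum, ih, mul_one]
    exact q.2.2

lemma sum_filter_wordProb_le_one (q : Distribution d) (P : (Fin n → Fin d) → Prop)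
    [DecidablePred P] : ∑ x with P x, wordProb q x ≤ 1 := by
  rw [← sum_wordProb (n := n) q]
  exact Finset.sum_le_sum_of_subset_of_nonneg (Finset.filter_subset _ _)
    fun x _ _ => wordProb_nonneg q x

lemma sum_wordProb_mul_sum (q : Distribution d) (g : Fin d → ℝ)
    (hg : ∑ i, (q : Fin d → ℝ) i * g i = 0) :
    ∑ x : Fin n → Fin d, wordProb q x * ∑ k, g (x k) = 0 := by
  induction n with
  | zero => simp
  | succ n ih =>
    have h : ∀ a, ∑ y : Fin n → Fin d, (q : Fin d → ℝ) a * wordProb q y * (g a + ∑ k, g (y k))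
        = (q : Fin d → ℝ) a * g a := fun a => by
      calc _ = (q : Fin d → ℝ) a * g a * ∑ y : Fin n → Fin d, wordProb q y
            + (q : Fin d → ℝ) a * ∑ y : Fin n → Fin d, wordProb q y * ∑ k, g (y k) := by
              rw [Finset.mul_sum, Finset.mul_sum, ← Finset.sum_add_distrib]
              exact Finset.sum_congr rfl fun y _ => by ring
        _ = _ := by rw [ih, sum_wordProb]; ring
    simp only [sum_words_succ, wordProb_cons, Fin.sum_univ_succ, Fin.cons_zero, Fin.cons_succ, h,
      hg]

/-- Variances of independent centred symbols add: the cross term vanishes by `sum_wordProb_mul_sum`.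
-/
lemma sum_wordProb_mul_sum_sq (q : Distribution d) (g : Fin d → ℝ)
    (hg : ∑ i, (q : Fin d → ℝ) i * g i = 0) :
    ∑ x : Fin n → Fin d, wordProb q x * (∑ k, g (x k)) ^ 2
      = n * ∑ i, (q : Fin d → ℝ) i * g i ^ 2 := by
  induction n with
  | zero => simp
  | succ n ih =>
    have h : ∀ a, ∑ y : Fin n → Fin d,
        (q : Fin d → ℝ) a * wordProb q y * (g a + ∑ k, g (y k)) ^ 2
        = (q : Fin d → ℝ) a * g a ^ 2
          + (q : Fin d → ℝ) a * (n * ∑ i, (q : Fin d → ℝ) i * g i ^ 2) := fun a => by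
      calc _ = (q : Fin d → ℝ) a * g a ^ 2 * ∑ y : Fin n → Fin d, wordProb q y
            + 2 * (q : Fin d → ℝ) a * g a * ∑ y : Fin n → Fin d, wordProb q y * ∑ k, g (y k)
            + (q : Fin d → ℝ) a * ∑ y : Fin n → Fin d, wordProb q y * (∑ k, g (y k)) ^ 2 := by
              rw [Finset.mul_sum, Finset.mul_sum, Finset.mul_sum, ← Finset.sum_add_distrib,
                ← Finset.sum_add_distrib]
              exact Finset.sum_congr rfl fun y _ => by ring
        _ = _ := by rw [ih, sum_wordProb, sum_wordProb_mul_sum q g hg]; ring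
    simp only [sum_words_succ, wordProb_cons, Fin.sum_univ_succ, Fin.cons_zero, Fin.cons_succ, h,
      Finset.sum_add_distrib, ← Finset.sum_mul]
    rw [show ∑ i, (q : Fin d → ℝ) i = 1 from q.2.2]
    push_cast
    ring

/-- Chebyshev's inequality for empirical means, uniform in the underlying distribution. -/
lemma weak_law (q : Distribution d) (f : Fin d → ℝ) {M δ : ℝ} (hM : ∀ i, |f i| ≤ M)
    (hδ : 0 < δ) (hn : 1 ≤ n) (P : (Fin n → Fin d) → Prop) [DecidablePred P]
    (hP : ∀ x, P x → n * δ ≤ |∑ k, f (x k) - n * ∑ i, (q : Fin d → ℝ) i * f i|) :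
    ∑ x with P x, wordProb q x ≤ M ^ 2 / δ ^ 2 / n := by
  obtain ⟨m, hm⟩ : ∃ m, m = ∑ i, (q : Fin d → ℝ) i * f i := ⟨_, rfl⟩
  rw [← hm] at hP
  have hq1 : ∑ i, (q : Fin d → ℝ) i = 1 := q.2.2
  have hn' : (0 : ℝ) < n := by exact_mod_cast hn
  have hg : ∑ i, (q : Fin d → ℝ) i * (f i - m) = 0 := by
    simp only [mul_sub, Finset.sum_sub_distrib, ← Finset.sum_mul, hq1, ← hm]; ring
  -- Bounding the variance by the second moment makes the constant independent of `q`.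
  have hvar : ∑ i, (q : Fin d → ℝ) i * (f i - m) ^ 2 ≤ M ^ 2 := by
    have h1 : ∑ i, (q : Fin d → ℝ) i * (f i - m) ^ 2
        = ∑ i, (q : Fin d → ℝ) i * f i ^ 2 - m ^ 2 := by
      calc _ = ∑ i, ((q : Fin d → ℝ) i * f i ^ 2 - 2 * m * ((q : Fin d → ℝ) i * f i)
                + m ^ 2 * (q : Fin d → ℝ) i) := Finset.sum_congr rfl fun i _ => by ring
        _ = _ := by
          rw [Finset.sum_add_distrib, Finset.sum_sub_distrib, ← Finset.mul_sum, ← Finset.mul_sum,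
            hq1, ← hm]; ring
    have h2 : ∑ i, (q : Fin d → ℝ) i * f i ^ 2 ≤ ∑ i, (q : Fin d → ℝ) i * M ^ 2 :=
      Finset.sum_le_sum fun i _ => mul_le_mul_of_nonneg_left
        (sq_le_sq' (abs_le.1 (hM i)).1 (abs_le.1 (hM i)).2) (q.2.1 i)
    rw [← Finset.sum_mul, hq1, one_mul] at h2
    nlinarith [sq_nonneg m]
  have key : (n * δ) ^ 2 * ∑ x with P x, wordProb q x ≤ n * M ^ 2 := by
    calc (n * δ) ^ 2 * ∑ x with P x, wordProb q x
        ≤ ∑ x with P x, wordProb q x * (∑ k, (f (x k) - m)) ^ 2 := by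
          rw [Finset.mul_sum]
          refine Finset.sum_le_sum fun x hx => ?_
          rw [mul_comm]
          refine mul_le_mul_of_nonneg_left ?_ (wordProb_nonneg q x)
          have := hP x (Finset.mem_filter.1 hx).2
          rw [← sq_abs (∑ k, (f (x k) - m))]
          refine pow_le_pow_left₀ (by positivity) ?_ 2
          simpa [Finset.sum_sub_distrib] using this
      _ ≤ ∑ x, wordProb q x * (∑ k, (f (x k) - m)) ^ 2 :=
          Finset.sum_le_sum_of_subset_of_nonneg (Finset.filter_subset _ _)
            fun x _ _ => mul_nonneg (wordProb_nonneg q x) (sq_nonneg _)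
      _ = n * ∑ i, (q : Fin d → ℝ) i * (f i - m) ^ 2 :=
          sum_wordProb_mul_sum_sq q (fun i => f i - m) hg
      _ ≤ n * M ^ 2 := by gcongr
  rw [div_div, le_div_iff₀ (by positivity)]
  refine le_of_mul_le_mul_left ?_ hn'
  linarith [key]

/-! ### Change of measure, indicator tests and continuity -/

lemma wordProb_eq_exp_mul {p q : Distribution d} (hp : ∀ i, 0 < (p : Fin d → ℝ) i)
    (hq : ∀ i, 0 < (q : Fin d → ℝ) i) (x : Fin n → Fin d) :
    wordProb q x
      = Real.exp (∑ k, Real.log ((q : Fin d → ℝ) (x k) / (p : Fin d → ℝ) (x k)))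
        * wordProb p x := by
  rw [Real.exp_sum, wordProb, wordProb, ← Finset.prod_mul_distrib]
  refine Finset.prod_congr rfl fun k _ => ?_
  rw [Real.exp_log (div_pos (hq _) (hp _)), div_mul_cancel₀ _ (hp _).ne']

lemma wordProb_le_exp_mul {q r : Distribution d} {η : ℝ}
    (h : ∀ i, (q : Fin d → ℝ) i ≤ Real.exp η * (r : Fin d → ℝ) i) (x : Fin n → Fin d) :
    wordProb q x ≤ Real.exp (n * η) * wordProb r x := by
  have : wordProb q x ≤ ∏ k, (Real.exp η * (r : Fin d → ℝ) (x k)) :=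
    Finset.prod_le_prod (fun k _ => q.2.1 _) fun k _ => h _
  rwa [Finset.prod_mul_distrib, Finset.prod_const, Finset.card_univ, Fintype.card_fin,
    ← Real.exp_nat_mul] at this

lemma falseAlarm_indicator (p : Distribution d) (P : (Fin n → Fin d) → Prop) [DecidablePred P] :
    falseAlarm p (fun x => if P x then 1 else 0) = ∑ x with P x, wordProb p x := by
  simp [falseAlarm, Finset.sum_filter]

lemma typeIIError_indicator (q : Distribution d) (P : (Fin n → Fin d) → Prop) [DecidablePred P] :
    typeIIError q (fun x => if P x then 1 else 0) = ∑ x with ¬ P x, wordProb q x := by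
  rw [typeIIError, Finset.sum_filter]
  exact Finset.sum_congr rfl fun x _ => by split_ifs <;> simp_all

lemma indicator_mem_decisionRules {p : Distribution d} {ε : ℝ} (P : (Fin n → Fin d) → Prop)
    [DecidablePred P] (h : ∑ x with P x, wordProb p x ≤ ε) :
    (fun x => if P x then 1 else 0) ∈ decisionRules p ε n :=
  ⟨fun x => by dsimp only; split_ifs <;> simp, (falseAlarm_indicator p P).trans_le h⟩

lemma typeIIError_nonneg (q : Distribution d) {φ : (Fin n → Fin d) → ℝ}
    (hφ : ∀ x, φ x ∈ Set.Icc (0 : ℝ) 1) : 0 ≤ typeIIError q φ :=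
  Finset.sum_nonneg fun x _ => mul_nonneg (sub_nonneg.2 (hφ x).2) (wordProb_nonneg q x)

lemma continuous_wordProb (x : Fin n → Fin d) :
    Continuous fun q : Distribution d => wordProb q x :=
  continuous_finsetProd _ fun k _ => (continuous_apply (x k)).comp continuous_subtype_val

lemma continuous_typeIIError (φ : (Fin n → Fin d) → ℝ) :
    Continuous fun q : Distribution d => typeIIError q φ := by
  unfold typeIIError
  exact continuous_finsetSum _ fun x _ => continuous_const.mul (continuous_wordProb x)

/-! ### Mixed strategies reduced to mean rules and mean word laws -/

/-- The behavioural rule that a mixed strategy of the defender induces. -/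
def meanRule {p : Distribution d} {ε : ℝ} (τ : ProbabilityMeasure (decisionRules p ε n))
    (x : Fin n → Fin d) : ℝ :=
  ∫ φ, (φ : (Fin n → Fin d) → ℝ) x ∂(τ : Measure (decisionRules p ε n))

/-- The law of the observed word under a mixed strategy of the attacker. -/
def meanWordProb {Q : Set (Distribution d)} (σ : ProbabilityMeasure Q) (x : Fin n → Fin d) : ℝ :=
  ∫ q, wordProb (q : Distribution d) x ∂(σ : Measure Q)

section Mixed

variable {p : Distribution d} {Q : Set (Distribution d)} {ε : ℝ}

lemma integrable_rule_apply (τ : ProbabilityMeasure (decisionRules p ε n)) (x : Fin n → Fin d) :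
    Integrable (fun φ : decisionRules p ε n => (φ : (Fin n → Fin d) → ℝ) x) (τ : Measure (decisionRules p ε n)) := by
  refine Integrable.of_bound (C := 1)
    ((measurable_pi_apply x).comp measurable_subtype_coe).aestronglyMeasurable
    (Eventually.of_forall fun φ => ?_)
  have h := φ.2.1 x
  rw [Real.norm_eq_abs, abs_of_nonneg h.1]
  exact h.2

lemma integrable_typeIIError_rule (τ : ProbabilityMeasure (decisionRules p ε n))
    (q : Distribution d) :
    Integrable (fun φ : decisionRules p ε n => typeIIError q (φ : (Fin n → Fin d) → ℝ))
      (τ : Measure (decisionRules p ε n)) := by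
  unfold typeIIError
  exact integrable_finsetSum _ fun x _ =>
    ((integrable_const 1).sub (integrable_rule_apply τ x)).mul_const _

lemma integral_typeIIError_rule (τ : ProbabilityMeasure (decisionRules p ε n))
    (q : Distribution d) :
    ∫ φ, typeIIError q (φ : (Fin n → Fin d) → ℝ) ∂(τ : Measure (decisionRules p ε n))
      = typeIIError q (meanRule τ) := by
  unfold typeIIError
  have hint : ∀ x, Integrable (fun φ : decisionRules p ε n =>
      (1 - (φ : (Fin n → Fin d) → ℝ) x) * wordProb q x) (τ : Measure (decisionRules p ε n)) :=
    fun x => ((integrable_const 1).sub (integrable_rule_apply τ x)).mul_const _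
  rw [integral_finsetSum _ fun x _ => hint x]
  refine Finset.sum_congr rfl fun x _ => ?_
  rw [integral_mul_const, integral_sub (integrable_const 1) (integrable_rule_apply τ x), meanRule]
  simp only [integral_const, probReal_univ, one_smul]

/-- The constraints defining the admissible rules are affine, so they survive averaging. -/
lemma meanRule_mem (τ : ProbabilityMeasure (decisionRules p ε n)) :
    meanRule τ ∈ decisionRules p ε n := by
  refine ⟨fun x => ⟨integral_nonneg fun φ => (φ.2.1 x).1, ?_⟩, ?_⟩
  · have := integral_mono (integrable_rule_apply τ x) (integrable_const (1 : ℝ))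
      fun φ => (φ.2.1 x).2
    simpa [meanRule] using this
  · have h : falseAlarm p (meanRule τ)
        = ∫ φ, falseAlarm p (φ : (Fin n → Fin d) → ℝ) ∂(τ : Measure (decisionRules p ε n)) := by
      unfold falseAlarm
      rw [integral_finsetSum _ fun x _ => (integrable_rule_apply τ x).mul_const _]
      exact Finset.sum_congr rfl fun x _ => by rw [integral_mul_const]; rfl
    rw [h]
    have hint : Integrable (fun φ : decisionRules p ε n => falseAlarm p (φ : (Fin n → Fin d) → ℝ))
        (τ : Measure (decisionRules p ε n)) := by
      unfold falseAlarm
      exact integrable_finsetSum _ fun x _ => (integrable_rule_apply τ x).mul_const _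
    have := integral_mono hint (integrable_const ε) fun φ => φ.2.2
    simpa using this

lemma integrable_of_continuous (hQ : IsClosed Q) (σ : ProbabilityMeasure Q) {f : Q → ℝ}
    (hf : Continuous f) : Integrable f (σ : Measure Q) := by
  have : CompactSpace Q := isCompact_iff_compactSpace.1 hQ.isCompact
  exact hf.integrable_of_hasCompactSupport (HasCompactSupport.of_compactSpace f)

lemma integrable_wordProb (hQ : IsClosed Q) (σ : ProbabilityMeasure Q) (x : Fin n → Fin d) :
    Integrable (fun q : Q => wordProb (q : Distribution d) x) (σ : Measure Q) :=
  integrable_of_continuous hQ σ ((continuous_wordProb x).comp continuous_subtype_val)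

lemma integrable_typeIIError (hQ : IsClosed Q) (σ : ProbabilityMeasure Q)
    (φ : (Fin n → Fin d) → ℝ) :
    Integrable (fun q : Q => typeIIError (q : Distribution d) φ) (σ : Measure Q) :=
  integrable_of_continuous hQ σ ((continuous_typeIIError φ).comp continuous_subtype_val)

lemma integrable_cost (hQ : IsClosed Q) (σ : ProbabilityMeasure Q) {c : Q → ℝ≥0}
    (hc : Continuous c) : Integrable (fun q => (c q : ℝ)) (σ : Measure Q) :=
  integrable_of_continuous hQ σ (NNReal.continuous_coe.comp hc)

lemma npError_eq_integral (σ : ProbabilityMeasure Q)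
    (τ : ProbabilityMeasure (decisionRules p ε n)) :
    npError p Q ε n σ τ
      = ∫ q, typeIIError (q : Distribution d) (meanRule τ) ∂(σ : Measure Q) := by
  simp only [npError, mixedExtension, defenderUtility, integral_neg, integral_typeIIError_rule,
    neg_neg]

lemma integral_typeIIError (hQ : IsClosed Q) (σ : ProbabilityMeasure Q)
    (φ : (Fin n → Fin d) → ℝ) :
    ∫ q, typeIIError (q : Distribution d) φ ∂(σ : Measure Q)
      = ∑ x, (1 - φ x) * meanWordProb σ x := by
  unfold typeIIError
  rw [integral_finsetSum _ fun x _ => (integrable_wordProb hQ σ x).const_mul _]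
  exact Finset.sum_congr rfl fun x _ => integral_const_mul _ _

lemma mixedExtension_attackerUtility (c : Q → ℝ≥0)
    (σ : ProbabilityMeasure Q) (τ : ProbabilityMeasure (decisionRules p ε n)) :
    mixedExtension (attackerUtility p Q c ε n) σ τ
      = ∫ q, (typeIIError (q : Distribution d) (meanRule τ) - (c q : ℝ)) ∂(σ : Measure Q) := by
  unfold mixedExtension attackerUtility
  refine integral_congr_ae (Eventually.of_forall fun q => ?_)
  change ∫ φ : decisionRules p ε n, (typeIIError (q : Distribution d) (φ : (Fin n → Fin d) → ℝ)
    - (c q : ℝ)) ∂(τ : Measure (decisionRules p ε n)) = _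
  rw [integral_sub (integrable_typeIIError_rule τ _) (integrable_const _), integral_typeIIError_rule]
  simp

/-! ### Consequences of equilibrium -/

variable {c : Q → ℝ≥0} {σ : ProbabilityMeasure Q} {τ : ProbabilityMeasure (decisionRules p ε n)}

lemma IsNPEquilibrium.attacker (h : IsNPEquilibrium p Q c ε n σ τ) (q : Q) :
    typeIIError (q : Distribution d) (meanRule τ) - (c q : ℝ)
      ≤ ∫ q, (typeIIError (q : Distribution d) (meanRule τ) - (c q : ℝ)) ∂(σ : Measure Q) := by
  let ν : ProbabilityMeasure Q := ⟨Measure.dirac q, inferInstance⟩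
  have h1 := h.1 ν
  rw [mixedExtension_attackerUtility, mixedExtension_attackerUtility] at h1
  have h2 : ∫ r, (typeIIError (r : Distribution d) (meanRule τ) - (c r : ℝ)) ∂(ν : Measure Q)
      = typeIIError (q : Distribution d) (meanRule τ) - (c q : ℝ) := integral_dirac _ _
  rwa [h2] at h1

lemma IsNPEquilibrium.defender (h : IsNPEquilibrium p Q c ε n σ τ)
    {φ : (Fin n → Fin d) → ℝ} (hφ : φ ∈ decisionRules p ε n) :
    npError p Q ε n σ τ ≤ ∫ q, typeIIError (q : Distribution d) φ ∂(σ : Measure Q) := by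
  let ν : ProbabilityMeasure (decisionRules p ε n) := ⟨Measure.dirac ⟨φ, hφ⟩, inferInstance⟩
  have h1 : npError p Q ε n σ τ ≤ npError p Q ε n σ ν := neg_le_neg (h.2 ν)
  have h2 : meanRule ν = φ := by
    funext x
    exact integral_dirac' (fun ψ : decisionRules p ε n => (ψ : (Fin n → Fin d) → ℝ) x) _
      ((measurable_pi_apply x).comp measurable_subtype_coe).stronglyMeasurable
  rwa [npError_eq_integral σ ν, h2] at h1

/-- The attacker's deviation to a cheapest distribution bounds her expected excess cost. -/
lemma IsNPEquilibrium.excess_cost_le (h : IsNPEquilibrium p Q c ε n σ τ) (hQ : IsClosed Q)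
    (hc : Continuous c) (q : Q) :
    typeIIError (q : Distribution d) (meanRule τ) + ∫ r, ((c r : ℝ) - c q) ∂(σ : Measure Q)
      ≤ npError p Q ε n σ τ := by
  have h1 := h.attacker q
  have hc' := integrable_cost hQ σ hc
  rw [integral_sub (integrable_typeIIError hQ σ _) hc', ← npError_eq_integral] at h1
  rw [integral_sub hc' (integrable_const _)]
  simp only [integral_const, probReal_univ, one_smul] at h1 ⊢
  linarith

/-- At a global minimizer of the cost the excess-cost term is nonnegative and can be dropped. -/
lemma IsNPEquilibrium.typeIIError_le (h : IsNPEquilibrium p Q c ε n σ τ) (hQ : IsClosed Q)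
    (hc : Continuous c) {q : Q} (hq : ∀ r, c q ≤ c r) :
    typeIIError (q : Distribution d) (meanRule τ) ≤ npError p Q ε n σ τ := by
  have h1 := h.excess_cost_le hQ hc q
  have h2 : 0 ≤ ∫ r, ((c r : ℝ) - c q) ∂(σ : Measure Q) :=
    integral_nonneg fun r => sub_nonneg.2 (NNReal.coe_le_coe.2 (hq r))
  linarith

/-- Almost every distribution the attacker plays is a best response. -/
lemma IsNPEquilibrium.ae_cost_le (h : IsNPEquilibrium p Q c ε n σ τ) (hQ : IsClosed Q)
    (hc : Continuous c) (r : Q) :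
    ∀ᵐ q ∂(σ : Measure Q),
      (c q : ℝ) - c r ≤ typeIIError (q : Distribution d) (meanRule τ) := by
  set f : Q → ℝ := fun q => typeIIError (q : Distribution d) (meanRule τ) - (c q : ℝ) with hf
  set v := ∫ q, f q ∂(σ : Measure Q) with hv
  have hfi : Integrable f (σ : Measure Q) :=
    (integrable_typeIIError hQ σ _).sub (integrable_cost hQ σ hc)
  have hle : ∀ q, f q ≤ v := h.attacker
  have h0 : ∫ q, (v - f q) ∂(σ : Measure Q) = 0 := by
    rw [integral_sub (integrable_const _) hfi]; simp [hv]
  rw [integral_eq_zero_iff_of_nonneg (fun q => sub_nonneg.2 (hle q))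
    ((integrable_const _).sub hfi)] at h0
  filter_upwards [h0] with q hq
  have h1 : v - f q = 0 := hq
  have h2 := hle r
  have h3 := typeIIError_nonneg (r : Distribution d) (meanRule_mem τ).1
  simp only [hf] at h1 h2
  linarith

/-- A Neyman–Pearson property: where the defender does not reject surely, the attacker's word law
is dominated by the null hypothesis up to the factor `1 / ε`. -/
lemma IsNPEquilibrium.meanWordProb_le (h : IsNPEquilibrium p Q c ε n σ τ) (hQ : IsClosed Q)
    (hε : 0 < ε) (hp : ∀ i, 0 < (p : Fin d → ℝ) i) {x : Fin n → Fin d}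
    (hx : meanRule τ x < 1) : ε * meanWordProb σ x ≤ wordProb p x := by
  classical
  set m := meanRule τ
  obtain ⟨hm, hmε⟩ := meanRule_mem τ
  have hpx := wordProb_pos hp x
  set K := ε / wordProb p x with hK
  have hK0 : 0 < K := div_pos hε hpx
  have hWnn : ∀ y : Fin n → Fin d, 0 ≤ meanWordProb σ y := fun y => integral_nonneg fun q => wordProb_nonneg _ y
  have hWsum : ∑ y : Fin n → Fin d, meanWordProb σ y = 1 := by
    unfold meanWordProb
    rw [← integral_finsetSum _ fun y _ => integrable_wordProb hQ σ y]
    simp [sum_wordProb]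
  -- The weight `l` is small enough that the extra mass `l * K` at `x` fits in the room `1 - m x`.
  obtain ⟨l, hl0, hl1, hlK⟩ : ∃ l : ℝ, 0 < l ∧ l ≤ 1 ∧ l * K ≤ 1 - m x := by
    refine ⟨min 1 ((1 - m x) / K), lt_min one_pos (div_pos (sub_pos.2 hx) hK0), min_le_left _ _, ?_⟩
    rw [← le_div_iff₀ hK0]; exact min_le_right _ _
  -- Exchange: scale `m` down by `1 - l` and spend the freed false alarm budget, `l * ε = l * K *
  -- wordProb p x`, on the word `x`. Optimality of `m` makes the gain `l * K * meanWordProb σ x` at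
  -- most the loss, which is at most `l`.
  let φ : (Fin n → Fin d) → ℝ := fun y => (1 - l) * m y + l * K * if y = x then 1 else 0
  have hφ : φ ∈ decisionRules p ε n := by
    refine ⟨fun y => ⟨?_, ?_⟩, ?_⟩
    · have := (hm y).1
      have : 0 ≤ 1 - l := by linarith
      dsimp only [φ]; positivity
    · have h0 := (hm y).1
      have h1 := (hm y).2
      have h2 : (1 - l) * m y ≤ m y := by nlinarith
      dsimp only [φ]
      split_ifs with hy
      · subst hy; linarith
      · linarith
    · have : falseAlarm p φ = (1 - l) * falseAlarm p m + l * K * wordProb p x := by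
        simp only [falseAlarm, φ, add_mul, Finset.sum_add_distrib, mul_assoc, ← Finset.mul_sum]
        simp
      rw [this, mul_assoc, hK, div_mul_cancel₀ _ hpx.ne']
      nlinarith
  have h1 := h.defender hφ
  rw [npError_eq_integral, integral_typeIIError hQ, integral_typeIIError hQ] at h1
  have h2 : ∑ y, (1 - φ y) * meanWordProb σ y
      = ∑ y, (1 - m y) * meanWordProb σ y + l * ∑ y, m y * meanWordProb σ y
        - l * K * meanWordProb σ x := by
    have : l * K * meanWordProb σ x
        = ∑ y, l * K * (if y = x then 1 else 0) * meanWordProb σ y := by simp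
    rw [this, Finset.mul_sum, ← Finset.sum_add_distrib, ← Finset.sum_sub_distrib]
    exact Finset.sum_congr rfl fun y _ => by dsimp only [φ]; ring
  have h3 : ∑ y, m y * meanWordProb σ y ≤ 1 := by
    rw [← hWsum]
    exact Finset.sum_le_sum fun y _ => mul_le_of_le_one_left (hWnn y) (hm y).2
  have h4 : K * meanWordProb σ x ≤ 1 := by
    have : l * (K * meanWordProb σ x) ≤ l * 1 := by
      change ∑ y, (1 - m y) * meanWordProb σ y ≤ _ at h1
      nlinarith
    exact le_of_mul_le_mul_left this hl0
  rw [hK, div_mul_eq_mul_div, div_le_one hpx] at h4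
  exact h4

end Mixed

end HypothesisGame

end

/-! ### Compactness estimates and likelihood balls -/

noncomputable section

namespace HypothesisGame

variable {d n : ℕ} {p : Distribution d} {Q : Set (Distribution d)} {c : Q → ℝ≥0} {ε : ℝ}

/-- Turns (A4), a comparison of relative entropies, into positivity of the mean of the
log-likelihood ratio. -/
lemma sum_mul_log_div_sub (q : Distribution d) {r s : Distribution d}
    (hq : ∀ i, 0 < (q : Fin d → ℝ) i) (hr : ∀ i, 0 < (r : Fin d → ℝ) i)
    (hs : ∀ i, 0 < (s : Fin d → ℝ) i) :
    ∑ i, (q : Fin d → ℝ) i * Real.log ((r : Fin d → ℝ) i / (s : Fin d → ℝ) i)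
      = relEntropy q s - relEntropy q r := by
  rw [relEntropy, relEntropy, ← Finset.sum_sub_distrib]
  refine Finset.sum_congr rfl fun i _ => ?_
  rw [Real.log_div (hr i).ne' (hs i).ne', Real.log_div (hq i).ne' (hs i).ne',
    Real.log_div (hq i).ne' (hr i).ne']
  ring

lemma exists_abs_le (f : Fin d → ℝ) : ∃ M, ∀ i, |f i| ≤ M :=
  ⟨∑ i, |f i|, fun i => Finset.single_le_sum (fun j _ => abs_nonneg (f j)) (Finset.mem_univ i)⟩

lemma exists_drift (hQ : IsClosed Q) (hne : Q.Nonempty) {f : Fin d → ℝ}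
    (hf : ∀ q ∈ Q, 0 < ∑ i, (q : Fin d → ℝ) i * f i) :
    ∃ γ > 0, ∀ q ∈ Q, 2 * γ ≤ ∑ i, (q : Fin d → ℝ) i * f i := by
  have hcont : Continuous fun q : Distribution d => ∑ i, (q : Fin d → ℝ) i * f i :=
    continuous_finsetSum _ fun i _ =>
      ((continuous_apply i).comp continuous_subtype_val).mul continuous_const
  obtain ⟨q₀, hq₀, hmin⟩ := hQ.isCompact.exists_isMinOn hne hcont.continuousOn
  exact ⟨_, half_pos (hf q₀ hq₀), fun q hq => by linarith [isMinOn_iff.1 hmin q hq]⟩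

/-- Off `U` the cost attains its minimum by compactness, and uniqueness makes that minimum exceed `c
r`. -/
lemma exists_cost_gap (hQ : IsClosed Q) (hc : Continuous c) {r : Q} (hmin : ∀ q, c r ≤ c q)
    (huniq : ∀ q', (∀ q, c q' ≤ c q) → q' = r) {U : Set Q} (hU : IsOpen U) (hr : r ∈ U) :
    ∃ κ : ℝ, 0 < κ ∧ ∀ q, (c q : ℝ) - c r < κ → q ∈ U := by
  have : CompactSpace Q := isCompact_iff_compactSpace.1 hQ.isCompact
  rcases Uᶜ.eq_empty_or_nonempty with h | h
  · exact ⟨1, one_pos, fun q _ => by rw [Set.compl_empty_iff.1 h]; trivial⟩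
  · obtain ⟨s, hs, hsmin⟩ := hU.isClosed_compl.isCompact.exists_isMinOn h hc.continuousOn
    refine ⟨c s - c r, ?_, fun q hq => ?_⟩
    · rw [sub_pos, NNReal.coe_lt_coe]
      refine (hmin s).lt_of_ne fun he => hs ?_
      rwa [huniq s fun q => he ▸ hmin q]
    · by_contra hqU
      have : (c s : ℝ) ≤ c q := NNReal.coe_le_coe.2 (isMinOn_iff.1 hsmin q hqU)
      linarith

/-- Distributions whose likelihoods agree with those of `r` up to the factor `exp η`. -/
def likelihoodBall (Q : Set (Distribution d)) (r : Distribution d) (η : ℝ) : Set Q :=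
  {q | ∀ i, ((q : Distribution d) : Fin d → ℝ) i < Real.exp η * (r : Fin d → ℝ) i ∧
    (r : Fin d → ℝ) i < Real.exp η * ((q : Distribution d) : Fin d → ℝ) i}

lemma isOpen_likelihoodBall (r : Distribution d) (η : ℝ) : IsOpen (likelihoodBall Q r η) := by
  have hcont : ∀ i, Continuous fun q : Q => ((q : Distribution d) : Fin d → ℝ) i := fun i =>
    (continuous_apply i).comp (continuous_subtype_val.comp continuous_subtype_val)
  simp only [likelihoodBall, Set.ofPred_forall]
  exact isOpen_iInter_of_finite fun i => (isOpen_lt (hcont i) continuous_const).inter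
    (isOpen_lt continuous_const (continuous_const.mul (hcont i)))

lemma mem_likelihoodBall_self {r : Q} (hr : ∀ i, 0 < ((r : Distribution d) : Fin d → ℝ) i)
    {η : ℝ} (hη : 0 < η) : r ∈ likelihoodBall Q (r : Distribution d) η := fun i =>
  have h := (lt_mul_iff_one_lt_left (hr i)).2 (Real.one_lt_exp_iff.2 hη)
  ⟨h, h⟩

/-- Under full support, zero error forces `φ = 1` everywhere, hence false alarm probability `1 > ε`.
-/
lemma typeIIError_pos {q : Distribution d} (hq : ∀ i, 0 < (q : Fin d → ℝ) i)
    {φ : (Fin n → Fin d) → ℝ} (hφ : φ ∈ decisionRules p ε n) (hε : ε < 1) :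
    0 < typeIIError q φ := by
  refine (typeIIError_nonneg q hφ.1).lt_of_ne fun h0 => ?_
  have h1 := (Finset.sum_eq_zero_iff_of_nonneg fun x _ =>
    mul_nonneg (sub_nonneg.2 (hφ.1 x).2) (wordProb_nonneg q x)).1 h0.symm
  have h2 : ∀ x, φ x = 1 := fun x => by
    rcases mul_eq_zero.1 (h1 x (Finset.mem_univ x)) with h | h
    · linarith
    · exact absurd h (wordProb_pos hq x).ne'
  have h3 := hφ.2
  simp only [falseAlarm, h2, one_mul, sum_wordProb] at h3
  linarith

lemma eventually_div_le (C : ℝ) {κ : ℝ} (hκ : 0 < κ) : ∀ᶠ n : ℕ in atTop, C / n < κ :=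
  (tendsto_const_div_atTop_nhds_zero_nat C).eventually_lt_const hκ

lemma eventually_exp_le {a κ : ℝ} (ha : 0 < a) (hκ : 0 < κ) :
    ∀ᶠ n : ℕ in atTop, Real.exp (-(n * a)) < κ :=
  (Real.tendsto_exp_neg_atTop_nhds_zero.comp
    (tendsto_natCast_atTop_atTop.atTop_mul_const ha)).eventually_lt_const hκ

/-! ### Stein's lemma -/

/-- Converse part of Stein's lemma. -/
lemma eventually_forall_typeIIError_ge (hε : ε < 1) (hp : ∀ i, 0 < (p : Fin d → ℝ) i)
    {q : Distribution d} (hq : ∀ i, 0 < (q : Fin d → ℝ) i) {δ : ℝ} (hδ : 0 < δ) :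
    ∀ᶠ n : ℕ in atTop, ∀ φ ∈ decisionRules p ε n,
      Real.exp (-(n * (relEntropy p q + δ))) ≤ typeIIError q φ := by
  obtain ⟨M, hM⟩ := exists_abs_le fun i =>
    Real.log ((p : Fin d → ℝ) i / (q : Fin d → ℝ) i)
  have hε' : 0 < (1 - ε) / 2 := by linarith
  filter_upwards [eventually_div_le (M ^ 2 / (δ / 2) ^ 2) hε', eventually_exp_le (half_pos hδ) hε',
    eventually_ge_atTop 1] with n hn1 hn2 hn φ hφ
  let S : (Fin n → Fin d) → ℝ := fun x =>
    ∑ k, Real.log ((p : Fin d → ℝ) (x k) / (q : Fin d → ℝ) (x k))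
  have hW : ∑ x with n * (relEntropy p q + δ / 2) ≤ S x, wordProb p x < (1 - ε) / 2 := by
    refine (weak_law p _ hM (half_pos hδ) hn _ fun x hx => ?_).trans_lt hn1
    refine le_trans ?_ (le_abs_self _)
    change _ ≤ S x - n * relEntropy p q
    linarith
  -- Off the atypical set `q` is at least the exponential factor times `p`; on it the left side is
  -- nonpositive. Summing leaves mass at least `1 - ε - (1 - ε) / 2`.
  have h1 : ∀ x, Real.exp (-(n * (relEntropy p q + δ / 2))) *
      (wordProb p x - φ x * wordProb p x -
        if n * (relEntropy p q + δ / 2) ≤ S x then wordProb p x else 0)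
      ≤ (1 - φ x) * wordProb q x := fun x => by
    have hφ0 := hφ.1 x
    have hp0 := wordProb_nonneg p x
    have hq0 := mul_nonneg (sub_nonneg.2 hφ0.2) (wordProb_nonneg q x)
    split_ifs with hx
    · refine le_trans (mul_nonpos_of_nonneg_of_nonpos (Real.exp_pos _).le ?_) hq0
      nlinarith [hφ0.1]
    · have h2 : Real.exp (-(n * (relEntropy p q + δ / 2))) * wordProb p x ≤ wordProb q x := by
        rw [wordProb_eq_exp_mul hq hp x, ← mul_assoc, ← Real.exp_add]
        refine mul_le_of_le_one_left (wordProb_nonneg q x) (Real.exp_le_one_iff.2 ?_)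
        change -(n * (relEntropy p q + δ / 2)) + S x ≤ 0
        linarith
      nlinarith [mul_le_mul_of_nonneg_left h2 (sub_nonneg.2 hφ0.2)]
  have h2 : Real.exp (-(n * (relEntropy p q + δ / 2))) * ((1 - ε) / 2) ≤ typeIIError q φ := by
    refine le_trans ?_ (Finset.sum_le_sum fun x _ => h1 x)
    rw [← Finset.mul_sum, Finset.sum_sub_distrib, Finset.sum_sub_distrib, sum_wordProb,
      ← Finset.sum_filter]
    have := hφ.2
    rw [falseAlarm] at this
    exact mul_le_mul_of_nonneg_left (by linarith) (Real.exp_pos _).le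
  refine le_trans ?_ h2
  -- The spare `δ / 2` in the exponent absorbs the constant `(1 - ε) / 2`.
  rw [show -(n * (relEntropy p q + δ)) = -(n * (relEntropy p q + δ / 2)) + -(n * (δ / 2)) by ring,
    Real.exp_add]
  exact mul_le_mul_of_nonneg_left hn2.le (Real.exp_pos _).le

/-- Direct part of Stein's lemma, uniformly over a likelihood ball around the alternative. -/
lemma eventually_exists_rule_typeIIError_le (hε : 0 < ε) (hp : ∀ i, 0 < (p : Fin d → ℝ) i)
    {r : Distribution d} (hr : ∀ i, 0 < (r : Fin d → ℝ) i) {δ : ℝ} (hδ : 0 < δ) (η : ℝ) :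
    ∀ᶠ n : ℕ in atTop, ∃ φ ∈ decisionRules p ε n, ∀ q ∈ likelihoodBall Q r η,
      typeIIError (q : Distribution d) φ ≤ Real.exp (-(n * (relEntropy p r - δ - η))) := by
  obtain ⟨M, hM⟩ := exists_abs_le fun i =>
    Real.log ((p : Fin d → ℝ) i / (r : Fin d → ℝ) i)
  filter_upwards [eventually_div_le (M ^ 2 / δ ^ 2) hε, eventually_ge_atTop 1] with n hn1 hn
  let S : (Fin n → Fin d) → ℝ := fun x =>
    ∑ k, Real.log ((p : Fin d → ℝ) (x k) / (r : Fin d → ℝ) (x k))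
  refine ⟨_, indicator_mem_decisionRules (fun x => S x ≤ n * (relEntropy p r - δ))
    ((weak_law p _ hM hδ hn _ fun x hx => ?_).trans hn1.le), fun q hq => ?_⟩
  · rw [abs_sub_comm]
    refine le_trans ?_ (le_abs_self _)
    change _ ≤ n * relEntropy p r - S x
    linarith
  · rw [typeIIError_indicator]
    calc ∑ x with ¬ S x ≤ n * (relEntropy p r - δ), wordProb (q : Distribution d) x
        ≤ ∑ x with ¬ S x ≤ n * (relEntropy p r - δ),
            Real.exp (-(n * (relEntropy p r - δ - η))) * wordProb p x := by
          refine Finset.sum_le_sum fun x hx => ?_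
          have hx' := not_le.1 (Finset.mem_filter.1 hx).2
          refine (wordProb_le_exp_mul (fun i => (hq i).1.le) x).trans ?_
          rw [wordProb_eq_exp_mul hr hp x, ← mul_assoc, ← Real.exp_add]
          refine mul_le_mul_of_nonneg_right (Real.exp_le_exp.2 ?_) (wordProb_nonneg r x)
          change _ ≤ -(n * (relEntropy p r - δ - η)) + S x
          linarith
      _ ≤ _ := by
          rw [← Finset.mul_sum]
          exact mul_le_of_le_one_right (Real.exp_pos _).le (sum_filter_wordProb_le_one p _)

/-! ### Localization of the attacker near the cheapest distribution -/

variable {σ : ProbabilityMeasure Q}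

/-- If the attacker's expected excess cost is small, she plays near the cheapest distribution with
probability at least one half. -/
lemma half_mul_wordProb_le_meanWordProb (hQ : IsClosed Q) (hc : Continuous c) {r : Q}
    (hmin : ∀ q, c r ≤ c q) {η κ : ℝ} (hκ : 0 < κ)
    (hgap : ∀ q, (c q : ℝ) - c r < κ → q ∈ likelihoodBall Q (r : Distribution d) η)
    (hcost : ∫ q, ((c q : ℝ) - c r) ∂(σ : Measure Q) ≤ κ / 2) (x : Fin n → Fin d) :
    1 / 2 * (Real.exp (-(n * η)) * wordProb (r : Distribution d) x) ≤ meanWordProb σ x := by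
  set A := Real.exp (-(n * η)) * wordProb (r : Distribution d) x with hA
  have hA0 : 0 ≤ A := mul_nonneg (Real.exp_pos _).le (wordProb_nonneg _ x)
  -- Markov's inequality in pointwise form: an affine function of the excess cost that is at most
  -- `A` near `r` and nonpositive once the excess reaches `κ`.
  have hpt : ∀ q : Q, A - A / κ * ((c q : ℝ) - c r) ≤ wordProb (q : Distribution d) x := fun q => by
    have h0 : (0 : ℝ) ≤ (c q : ℝ) - c r := sub_nonneg.2 (NNReal.coe_le_coe.2 (hmin q))
    by_cases h : (c q : ℝ) - c r < κ
    · have h1 := wordProb_le_exp_mul (fun i => (hgap q h i).2.le) x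
      have h2 : A ≤ wordProb (q : Distribution d) x := by
        calc A ≤ Real.exp (-(n * η)) * (Real.exp (n * η) * wordProb (q : Distribution d) x) :=
              mul_le_mul_of_nonneg_left h1 (Real.exp_pos _).le
          _ = _ := by rw [← mul_assoc, ← Real.exp_add]; simp
      have : 0 ≤ A / κ * ((c q : ℝ) - c r) := by positivity
      linarith
    · have h1 : A / κ * κ ≤ A / κ * ((c q : ℝ) - c r) :=
        mul_le_mul_of_nonneg_left (not_lt.1 h) (by positivity)
      rw [div_mul_cancel₀ _ hκ.ne'] at h1
      linarith [wordProb_nonneg (q : Distribution d) x]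
  have hci : Integrable (fun q => (c q : ℝ) - c r) (σ : Measure Q) :=
    (integrable_cost hQ σ hc).sub (integrable_const _)
  have h := integral_mono ((integrable_const A).sub (hci.const_mul (A / κ)))
    (integrable_wordProb hQ σ x) hpt
  have h2 : ∫ q, (A - A / κ * ((c q : ℝ) - c r)) ∂(σ : Measure Q)
      = A - A / κ * ∫ q, ((c q : ℝ) - c r) ∂(σ : Measure Q) := by
    rw [integral_sub (integrable_const A) (hci.const_mul _), integral_const_mul (A / κ), integral_const,
      probReal_univ, one_smul]
  have h3 : A / κ * ∫ q, ((c q : ℝ) - c r) ∂(σ : Measure Q) ≤ A / κ * (κ / 2) :=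
    mul_le_mul_of_nonneg_left hcost (by positivity)
  have h4 : A / κ * (κ / 2) = A / 2 := by field_simp
  change ∫ q, (A - A / κ * ((c q : ℝ) - c r)) ∂(σ : Measure Q) ≤ meanWordProb σ x at h
  linarith

/-- In equilibrium and for long words, the attacker only plays distributions near the cheapest
one. -/
lemma eventually_ae_mem_likelihoodBall (hε : 0 < ε) (hQ : IsClosed Q)
    (hp : ∀ i, 0 < (p : Fin d → ℝ) i) (hQpos : ∀ q ∈ Q, ∀ i, 0 < (q : Fin d → ℝ) i)
    (hc : Continuous c) {r : Q} (hmin : ∀ q, c r ≤ c q)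
    (huniq : ∀ q', (∀ q, c q' ≤ c q) → q' = r)
    (hfar : {μ | relEntropy μ p ≤ relEntropy μ r} ∩ Q = ∅) {η : ℝ} (hη : 0 < η) :
    ∀ᶠ n : ℕ in atTop, ∀ (σ : ProbabilityMeasure Q) (τ : ProbabilityMeasure (decisionRules p ε n)),
      IsNPEquilibrium p Q c ε n σ τ →
        ∀ᵐ q ∂(σ : Measure Q), q ∈ likelihoodBall Q (r : Distribution d) η := by
  have hr := hQpos r r.2
  let f : Fin d → ℝ := fun i =>
    Real.log (((r : Distribution d) : Fin d → ℝ) i / (p : Fin d → ℝ) i)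
  obtain ⟨M, hM⟩ := exists_abs_le f
  obtain ⟨γ, hγ, hdrift⟩ := exists_drift (f := f) hQ ⟨r, r.2⟩ fun q hq => by
    rw [sum_mul_log_div_sub q (hQpos q hq) hr hp, sub_pos]
    by_contra hle
    exact (Set.mem_empty_iff_false q).1 (hfar ▸ ⟨not_lt.1 hle, hq⟩)
  obtain ⟨κ, hκ, hgap⟩ := exists_cost_gap hQ hc hmin huniq
    (isOpen_likelihoodBall (r : Distribution d) η) (mem_likelihoodBall_self hr hη)
  -- Radius `γ / 2` costs a factor `exp (-(n * (γ / 2)))`, leaving half of the exponent `n * γ`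
  -- gained on the half-space.
  obtain ⟨κ', hκ', hgap'⟩ := exists_cost_gap hQ hc hmin huniq
    (isOpen_likelihoodBall (r : Distribution d) (γ / 2))
    (mem_likelihoodBall_self hr (half_pos hγ))
  filter_upwards [eventually_div_le (M ^ 2 / γ ^ 2) hκ,
    eventually_div_le (M ^ 2 / γ ^ 2) (half_pos hκ'), eventually_exp_le hγ hε,
    eventually_exp_le (half_pos hγ) (half_pos hε), eventually_ge_atTop 1]
    with n hn1 hn2 hn3 hn4 hn σ τ h
  have hpow : ∀ q ∈ Q, ∑ x : Fin n → Fin d with ¬ n * γ ≤ ∑ k, f (x k), wordProb q x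
      ≤ M ^ 2 / γ ^ 2 / n := fun q hq => by
    refine weak_law q f hM hγ hn _ fun x hx => ?_
    rw [abs_sub_comm]
    refine le_trans ?_ (le_abs_self _)
    have h1 := mul_le_mul_of_nonneg_left (hdrift q hq) (Nat.cast_nonneg (α := ℝ) n)
    linarith [not_le.1 hx]
  have hmem : (fun x : Fin n → Fin d => if n * γ ≤ ∑ k, f (x k) then (1 : ℝ) else 0)
      ∈ decisionRules p ε n := by
    refine indicator_mem_decisionRules _ (le_trans ?_ hn3.le)
    calc ∑ x : Fin n → Fin d with n * γ ≤ ∑ k, f (x k), wordProb p x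
        ≤ ∑ x : Fin n → Fin d with n * γ ≤ ∑ k, f (x k),
            Real.exp (-(n * γ)) * wordProb (r : Distribution d) x := by
          refine Finset.sum_le_sum fun x hx => ?_
          rw [wordProb_eq_exp_mul hp hr x, ← mul_assoc, ← Real.exp_add]
          refine le_mul_of_one_le_left (wordProb_nonneg p x) (Real.one_le_exp ?_)
          have := (Finset.mem_filter.1 hx).2
          change 0 ≤ -(n * γ) + ∑ k, f (x k)
          linarith
      _ ≤ _ := by
          rw [← Finset.mul_sum]
          exact mul_le_of_le_one_right (Real.exp_pos _).le (sum_filter_wordProb_le_one _ _)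
  have herr : npError p Q ε n σ τ ≤ M ^ 2 / γ ^ 2 / n := by
    refine (h.defender hmem).trans ?_
    have := integral_mono (integrable_typeIIError hQ σ _) (integrable_const (M ^ 2 / γ ^ 2 / n))
      fun q => (typeIIError_indicator (q : Distribution d) _).trans_le (hpow q q.2)
    simpa using this
  have hcost : ∫ q, ((c q : ℝ) - c r) ∂(σ : Measure Q) ≤ κ' / 2 := by
    have h1 := h.excess_cost_le hQ hc r
    have h2 := typeIIError_nonneg (r : Distribution d) (meanRule_mem τ).1
    linarith
  -- On the half-space the attacker's word law exceeds `wordProb p x / ε`, so by the exchange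
  -- property the defender cannot accept with positive probability.
  have hreject : ∀ x : Fin n → Fin d, n * γ ≤ ∑ k, f (x k) → meanRule τ x = 1 := fun x hx => by
    refine le_antisymm ((meanRule_mem τ).1 x).2 (not_lt.1 fun hlt => ?_)
    have h1 := h.meanWordProb_le hQ hε hp hlt
    have h2 := half_mul_wordProb_le_meanWordProb hQ hc hmin hκ' hgap' hcost x
    have hpx := wordProb_pos hp x
    rw [wordProb_eq_exp_mul hp hr x, ← mul_assoc (Real.exp _), ← Real.exp_add] at h2
    have h3 : Real.exp (n * (γ / 2)) ≤ Real.exp (-(n * (γ / 2)) + ∑ k, f (x k)) :=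
      Real.exp_le_exp.2 (by linarith)
    have h4 : 1 / 2 * (Real.exp (n * (γ / 2)) * wordProb p x) ≤ meanWordProb σ x := by
      refine le_trans ?_ h2
      gcongr
    have h5 : ε * (1 / 2 * (Real.exp (n * (γ / 2)) * wordProb p x)) ≤ 1 * wordProb p x := by
      rw [one_mul]
      exact (mul_le_mul_of_nonneg_left h4 hε.le).trans h1
    have h6 : ε / 2 * Real.exp (n * (γ / 2)) ≤ 1 :=
      le_of_mul_le_mul_right (by linarith) hpx
    have h7 := mul_lt_mul_of_pos_right hn4 (Real.exp_pos (n * (γ / 2)))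
    rw [← Real.exp_add, neg_add_cancel, Real.exp_zero] at h7
    linarith
  -- `meanRule` dominates the half-space test, so its error against each `q` separately, not merely
  -- on average, is below the cost gap `κ`.
  filter_upwards [h.ae_cost_le hQ hc r] with q hq
  refine hgap q ((hq.trans ?_).trans_lt hn1)
  refine le_trans ?_ (hpow q q.2)
  rw [← typeIIError_indicator]
  refine Finset.sum_le_sum fun x _ => mul_le_mul_of_nonneg_right ?_ (wordProb_nonneg _ x)
  have h0 := ((meanRule_mem τ).1 x).1
  dsimp only
  split_ifs with hx
  · rw [hreject x hx]
  · linarith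

end HypothesisGame

end

/-! ### The error exponent -/

theorem mainTheorem2
    (d : ℕ) (p : HypothesisGame.Distribution d)
    (Q : Set (HypothesisGame.Distribution d)) (c : Q → ℝ≥0) (qstar : Q)
    (ε : ℝ) (hε0 : 0 < ε) (hε1 : ε < 1)
    -- (A1)
    (hQ_closed : IsClosed Q) (hpQ : p ∉ Q)
    -- (A2)
    (hp_pos : ∀ i, 0 < (p : Fin d → ℝ) i)
    (hQ_pos : ∀ q ∈ Q, ∀ i, 0 < (q : Fin d → ℝ) i)
    -- (A3)
    (hc : Continuous c)
    (hmin : ∀ q : Q, c qstar ≤ c q)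
    (hmin_unique : ∀ q' : Q, (∀ q : Q, c q' ≤ c q) → q' = qstar)
    -- (A4)
    (hfar : {μ : HypothesisGame.Distribution d |
      HypothesisGame.relEntropy μ p ≤ HypothesisGame.relEntropy μ qstar} ∩ Q = ∅)
    (σA : ℕ → ProbabilityMeasure Q)
    (σD : (n : ℕ) → ProbabilityMeasure (HypothesisGame.decisionRules p ε n))
    (hNE : ∀ n : ℕ, 1 ≤ n → HypothesisGame.IsNPEquilibrium p Q c ε n (σA n) (σD n)) :
    (∀ n : ℕ, 1 ≤ n → 0 < HypothesisGame.npError p Q ε n (σA n) (σD n)) ∧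
    Tendsto
      (fun n : ℕ => (1 / (n : ℝ)) *
        Real.log (HypothesisGame.npError p Q ε n (σA n) (σD n)))
      atTop (𝓝 (-HypothesisGame.relEntropy p qstar)) := by
  have hr := hQ_pos qstar qstar.2
  have hpos : ∀ n : ℕ, 1 ≤ n → 0 < HypothesisGame.npError p Q ε n (σA n) (σD n) := fun n hn =>
    (HypothesisGame.typeIIError_pos hr (HypothesisGame.meanRule_mem (σD n)) hε1).trans_le
      ((hNE n hn).typeIIError_le hQ_closed hc hmin)
  refine ⟨hpos, Metric.tendsto_atTop'.2 fun δ hδ => ?_⟩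
  -- One third of `δ` pays for Stein's test and one for the radius of the ball; the last keeps the
  -- inequality strict.
  have hδ3 : 0 < δ / 3 := by positivity
  have hev := ((HypothesisGame.eventually_forall_typeIIError_ge hε1 hp_pos hr (half_pos hδ)).and
    (HypothesisGame.eventually_exists_rule_typeIIError_le (Q := Q) hε0 hp_pos hr hδ3 (δ / 3))).and
    ((HypothesisGame.eventually_ae_mem_likelihoodBall hε0 hQ_closed hp_pos hQ_pos hc hmin
      hmin_unique hfar hδ3).and (eventually_ge_atTop 1))
  obtain ⟨N, hN⟩ := eventually_atTop.1 hev
  refine ⟨N, fun n hnN => ?_⟩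
  obtain ⟨⟨hlow, φ, hφ, hup⟩, hae, hn⟩ := hN n hnN.le
  have hn' : (0 : ℝ) < n := by exact_mod_cast hn
  have h1 := (hlow _ (HypothesisGame.meanRule_mem (σD n))).trans
    ((hNE n hn).typeIIError_le hQ_closed hc hmin)
  have h2 : HypothesisGame.npError p Q ε n (σA n) (σD n)
      ≤ Real.exp (-(n * (HypothesisGame.relEntropy p qstar - δ / 3 - δ / 3))) := by
    refine ((hNE n hn).defender hφ).trans ?_
    have := integral_mono_ae (HypothesisGame.integrable_typeIIError hQ_closed (σA n) φ)
      (integrable_const (Real.exp (-(n * (HypothesisGame.relEntropy p qstar - δ / 3 - δ / 3)))))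
      ((hae _ _ (hNE n hn)).mono fun q hq => hup q hq)
    simpa using this
  have h3 := (Real.le_log_iff_exp_le (hpos n hn)).2 h1
  have h4 := (Real.log_le_iff_le_exp (hpos n hn)).2 h2
  rw [Real.dist_eq, one_div_mul_eq_div, abs_lt]
  constructor
  · have : -(HypothesisGame.relEntropy p qstar + δ / 2)
        ≤ Real.log (HypothesisGame.npError p Q ε n (σA n) (σD n)) / n := by
      rw [le_div_iff₀ hn']; linarith
    linarith
  · have : Real.log (HypothesisGame.npError p Q ε n (σA n) (σD n)) / n
        ≤ -(HypothesisGame.relEntropy p qstar - δ / 3 - δ / 3) := by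
      rw [div_le_iff₀ hn']; linarith
    linarith
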